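/- Let $n,k\ge 1$. A weighted partition of $[n]=\{1,\dots,n\}$ with $k$ layers consists of $k$ layers, each a set of non-empty pairwise disjoint subsets (blocks) of $[n]$, such that the blocks of the first layer cover $[n]$, each block of a layer is contained in a block of every earlier layer, and every block of the layers $2,\dots,k$ has at least two elements (these layers need not cover $[n]$ and may be empty). The set of weighted partitions is $\mathcal P_n^{(k)}$, and $\mathcal P_n^{(k)}(r)$ is the set of those with exactly $r$ blocks in the first layer. For $\pi\in\mathcal P_n^{(k)}$, $i\in[n]$ and $1\le l\le k$, let $B^{(l)}(i)$ be the block of the $l$-th layer of $\pi$ that contains $i$, or $\{i\}$ if there is none. Say that $\pi'$ covers $\pi$, written $\pi\lessdot\pi'$, if there are $1\le\alpha<\beta\le n$ and $1\le l\le k$ such that (a) $B^{(1)}(\alpha)\ne B^{(1)}(\beta)$ and $\beta=\min B^{(1)}(\beta)$; (b) $B^{(l)}(\alpha)\neq B^{(l)}(\beta)$, $\alpha=\min B^{(l)}(\alpha)$ and $\beta=\min B^{(l)}(\beta)$; and $\pi'$ is obtained from $\pi$ by replacing, in each layer $l'\le l$, the blocks $B^{(l')}(\alpha)$ and $B^{(l')}(\beta)$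 by their union, leaving the layers $l'>l$ unchanged. Order $\mathcal P_n^{(k)}$ by the reflexive transitive closure $\le$ of $\lessdot$, and let $\hat 0=1/2/\cdots/n$ be the weighted partition whose first-layer blocks are all singletons and whose other layers are empty. Let $\mu$ be the Möbius function of this finite poset, $\mu(x,x)=1$ and $\mu(x,y)=-\sum_{x\le z<y}\mu(x,z)$ for $x<y$. Define the Whitney numbers of the first kind and the characteristic polynomial by $$w_r^{(n,k)}:=\sum_{\pi\in\mathcal P_n^{(k)}(r)}\mu(\hat 0,\pi),\qquad P_n^{(k)}(x):=\sum_{r=1}^{n}w_r^{(n,k)}x^r .$$ Then $$P_n^{(k)}(x)=\prod_{j=0}^{n-1}(x-kj),$$ and hence $w_r^{(n,k)}=k^{\,n-r}s(n,r)$ for $1\le r\le n$, where $s(n,r)$ is the signed Stirling number of the first kind, defined by $x(x-1)\cdots(x-n+1)=\sum_{r=0}^{n}s(n,r)x^r$. -/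

import Mathlib

open Finset Polynomial

/-- A weighted partition of an `n`-element linearly ordered set (here `Fin n`, standing for
`{1 < 2 < ⋯ < n}`) with `k ≥ 1` layers; the layers are numbered `0, …, k - 1`, so the first layer
has index `0`.  Each layer is a set of non-empty pairwise disjoint blocks.  The first layer is a
partition of the whole ground set, every block of a deeper layer lies inside a block of each
earlier layer, and the blocks of the layers after the first have at least two elements (elements
that are not covered by a deeper layer are allowed, and such a layer may be empty). -/
@[ext]
structure WeightedPartition (n k : ℕ) [NeZero k] where
  layer : Fin k → Finset (Finset (Fin n))
  block_nonempty : ∀ l, ∀ B ∈ layer l, B.Nonempty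
  block_disjoint : ∀ l, ∀ B ∈ layer l, ∀ C ∈ layer l, B ≠ C → Disjoint B C
  first_covers : ∀ i, ∃ B ∈ layer 0, i ∈ B
  two_le_card : ∀ l, l ≠ 0 → ∀ B ∈ layer l, 2 ≤ B.card
  refines : ∀ l l', l ≤ l' → ∀ B ∈ layer l', ∃ C ∈ layer l, B ⊆ C

namespace WeightedPartition

variable {n k : ℕ} [NeZero k]

/-- The number of blocks of a weighted partition (the blocks of its first layer). -/
def numBlocks (x : WeightedPartition n k) : ℕ := (x.layer 0).card

/-- The block of `i` in the `l`-th layer, viewed as a partition of the whole ground set: the block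
of the `l`-th layer that contains `i`, or the singleton `{i}` if there is none. -/
def blockOf (x : WeightedPartition n k) (l : Fin k) (i : Fin n) : Finset (Fin n) :=
  Finset.univ.filter fun j => j = i ∨ ∃ B ∈ x.layer l, i ∈ B ∧ j ∈ B

/-- The label `(a, b)` in layer `l` is admissible for `x`: `a < b`; the points `a` and `b` lie in
different blocks of the first layer and `b` is the least element of its block there; and in the
`l`-th layer `a` and `b` lie in different blocks, each being the least element of its block. -/
def Admissible (x : WeightedPartition n k) (a b : Fin n) (l : Fin k) : Prop :=
  a < b ∧
    (x.blockOf 0 a ≠ x.blockOf 0 b ∧ ∀ j ∈ x.blockOf 0 b, b ≤ j) ∧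
    (x.blockOf l a ≠ x.blockOf l b ∧
      (∀ j ∈ x.blockOf l a, a ≤ j) ∧ ∀ j ∈ x.blockOf l b, b ≤ j)

/-- `y` covers `x`: for some admissible label `(a, b)` in layer `l`, `y` is obtained from `x` by
merging the block of `a` with the block of `b` in each of the layers up to the `l`-th one and
leaving the deeper layers unchanged. -/
def Cover (x y : WeightedPartition n k) : Prop :=
  ∃ (a b : Fin n) (l : Fin k), x.Admissible a b l ∧
    ∀ l', y.layer l' =
      if l' ≤ l then
        insert (x.blockOf l' a ∪ x.blockOf l' b)
          (((x.layer l').erase (x.blockOf l' a)).erase (x.blockOf l' b))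
      else x.layer l'

theorem blockOf_zero_mem (x : WeightedPartition n k) (i : Fin n) : x.blockOf 0 i ∈ x.layer 0 := by
  obtain ⟨B, hB, hi⟩ := x.first_covers i
  have h : x.blockOf 0 i = B := by
    ext j
    simp only [blockOf, mem_filter, mem_univ, true_and]
    constructor
    · rintro (rfl | ⟨C, hC, hiC, hjC⟩)
      · exact hi
      · by_contra hj
        have hne : B ≠ C := fun h => hj (h ▸ hjC)
        exact Finset.disjoint_left.1 (x.block_disjoint 0 B hB C hC hne) hi hiC
    · intro hj
      exact Or.inr ⟨B, hB, hi, hj⟩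
  rw [h]
  exact hB

theorem Cover.numBlocks_lt {x y : WeightedPartition n k} (h : Cover x y) :
    y.numBlocks < x.numBlocks := by
  obtain ⟨a, b, l, hadm, hy⟩ := h
  have hne := hadm.2.1.1
  have ha := x.blockOf_zero_mem a
  have hb := x.blockOf_zero_mem b
  have h0 := hy 0
  rw [if_pos (Fin.zero_le l)] at h0
  have hb' : x.blockOf 0 b ∈ (x.layer 0).erase (x.blockOf 0 a) :=
    mem_erase.2 ⟨hne.symm, hb⟩
  have h1 := card_erase_add_one ha
  have h2 := card_erase_add_one hb'
  have h3 := card_insert_le (x.blockOf 0 a ∪ x.blockOf 0 b)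
    (((x.layer 0).erase (x.blockOf 0 a)).erase (x.blockOf 0 b))
  unfold numBlocks
  rw [h0]
  omega

theorem eq_or_numBlocks_lt {x y : WeightedPartition n k} (h : Relation.ReflTransGen Cover x y) :
    x = y ∨ y.numBlocks < x.numBlocks := by
  induction h with
  | refl => exact Or.inl rfl
  | tail _ hc ih =>
    rcases ih with rfl | ih
    · exact Or.inr hc.numBlocks_lt
    · exact Or.inr (hc.numBlocks_lt.trans ih)

/-- The order on weighted partitions: `x ≤ y` if there is a finite (possibly empty) sequence of
covers leading from `x` to `y`. -/
instance : PartialOrder (WeightedPartition n k) where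
  le x y := Relation.ReflTransGen Cover x y
  le_refl _ := Relation.ReflTransGen.refl
  le_trans _ _ _ := Relation.ReflTransGen.trans
  le_antisymm x y hxy hyx := by
    rcases eq_or_numBlocks_lt hxy with h | h
    · exact h
    · rcases eq_or_numBlocks_lt hyx with h' | h'
      · exact h'.symm
      · omega

noncomputable instance : DecidableEq (WeightedPartition n k) := Classical.decEq _

noncomputable instance : Fintype (WeightedPartition n k) :=
  Fintype.ofInjective (fun x : WeightedPartition n k => x.layer) fun _ _ h =>
    WeightedPartition.ext h

open Classical in
noncomputable instance : LocallyFiniteOrder (WeightedPartition n k) :=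
  Fintype.toLocallyFiniteOrder

/-- The weighted partition `1/2/⋯/n`: all blocks of the first layer are singletons and all other
layers are empty. -/
def zeroHat (n k : ℕ) [NeZero k] : WeightedPartition n k where
  layer l := if l = 0 then Finset.univ.image fun i => {i} else ∅
  block_nonempty l B hB := by
    split_ifs at hB
    · obtain ⟨i, -, rfl⟩ := mem_image.1 hB
      exact singleton_nonempty i
    · simp at hB
  block_disjoint l B hB C hC hne := by
    split_ifs at hB hC
    · obtain ⟨i, -, rfl⟩ := mem_image.1 hB
      obtain ⟨j, -, rfl⟩ := mem_image.1 hC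
      exact disjoint_singleton.2 fun h => hne (by rw [h])
    · simp at hB
  first_covers i := ⟨{i}, by simp, by simp⟩
  two_le_card l hl B hB := by simp [hl] at hB
  refines l l' h B hB := by
    split_ifs at hB with h'
    · subst h'
      have hl : l = 0 := nonpos_iff_eq_zero.1 h
      exact ⟨B, by simpa [hl] using hB, Subset.rfl⟩
    · simp at hB

/-- The Whitney number of the first kind `w_r^{(n,k)} = ∑ μ(0̂, π)`, the sum being over the weighted
partitions `π` with `r` blocks. -/
noncomputable def whitneyFirst (n k : ℕ) [NeZero k] (r : ℕ) : ℤ :=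
  ∑ π : WeightedPartition n k with π.numBlocks = r, IncidenceAlgebra.mu ℤ (zeroHat n k) π

/-- The characteristic polynomial `∑_{r = 1}^{n} w_r^{(n,k)} x ^ r`. -/
noncomputable def charPoly (n k : ℕ) [NeZero k] : ℤ[X] :=
  ∑ r ∈ Finset.Icc 1 n, C (whitneyFirst n k r) * X ^ r

end WeightedPartition

/-- The (signed) Stirling number of the first kind `s(n, r)`: the coefficient of `x ^ r` in the
falling factorial `x (x - 1) ⋯ (x - n + 1)`. -/
noncomputable def signedStirlingFirst (n r : ℕ) : ℤ := (descPochhammer ℤ n).coeff r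

/-!
Consider forests on `Fin n` in which every non-root vertex `b` is joined to a parent `a < b` by an
edge with one of `k` colours. The components of the subforests of the edges of colour at least `l`
are the layers of a weighted partition, and this partition lies below `x` if and only if, for every
edge, the pair of its parent and its colour belongs to a set that depends only on `x` and on the
child `b`. Hence the sum of `(-1) ^ #edges` over the forests lying below `x` factors over the
vertices. If `x ≠ 0̂`, then some vertex has exactly one possible edge and its factor is `1 - 1 = 0`,
so by Möbius inversion `μ(0̂, x)` is the sum of `(-1) ^ #edges` over the forests whose partition is
`x`. The characteristic polynomial is therefore the sum of `(-1) ^ #edges * X ^ #roots` over all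
forests; it factors over the vertices too, and the vertex `j` has `k * j` possible edges.
-/

theorem mu_bot_eq_sum_fiber {ι α R : Type*} [Fintype ι] [PartialOrder α] [OrderBot α]
    [LocallyFiniteOrder α] [DecidableEq α] [DecidableLE α] [Ring R] (φ : ι → α) (w : ι → R)
    (hw : ∀ x, ∑ i with φ i ≤ x, w i = if x = ⊥ then 1 else 0) (x : α) :
    IncidenceAlgebra.mu R ⊥ x = ∑ i with φ i = x, w i := by
  have hsum (y : α) : (if y = ⊥ then (1 : R) else 0) = ∑ z ∈ Iic y, ∑ i with φ i = z, w i := by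
    simp only [sum_fiberwise_eq_sum_filter, mem_Iic, hw]
  rw [IncidenceAlgebra.moebius_inversion_bot _ _ hsum x]
  simp

theorem scaleRoots_descPochhammer {R : Type*} [CommRing R] [NoZeroDivisors R] (n : ℕ) (c : R) :
    (descPochhammer R n).scaleRoots c = ∏ j ∈ range n, (X - C (c * j)) := by
  induction n with
  | zero => simp
  | succ n ih =>
    have hlinear : (X - (n : R[X])).scaleRoots c = X - C (c * n) := by
      simpa [sub_eq_add_neg, mul_comm] using X_add_C_scaleRoots (-(n : R)) c
    rw [prod_range_succ, ← ih, descPochhammer_succ_right, mul_scaleRoots_of_noZeroDivisors,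
      hlinear]

theorem finpartition_ofSetoid_mono {α : Type*} [Fintype α] [DecidableEq α] {r s : Setoid α}
    [DecidableRel r.r] [DecidableRel s.r] (h : r ≤ s) :
    Finpartition.ofSetoid r ≤ Finpartition.ofSetoid s := by
  intro B hB
  obtain ⟨a, ha⟩ := (Finpartition.ofSetoid r).nonempty_of_mem_parts hB
  refine ⟨_, (Finpartition.ofSetoid s).part_mem.2 (mem_univ a), fun b hb => ?_⟩
  rw [← (Finpartition.ofSetoid r).part_eq_of_mem hB ha] at hb
  exact Finpartition.mem_part_ofSetoid_iff_rel.2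
    (h (Finpartition.mem_part_ofSetoid_iff_rel.1 hb))

namespace WeightedPartition

variable {n k : ℕ} [NeZero k]

section Blocks

variable {x y : WeightedPartition n k} {l l' : Fin k} {i j : Fin n} {B : Finset (Fin n)}

theorem mem_blockOf : j ∈ x.blockOf l i ↔ j = i ∨ ∃ B ∈ x.layer l, i ∈ B ∧ j ∈ B := by
  simp [blockOf]

theorem mem_blockOf_self (x : WeightedPartition n k) (l : Fin k) (i : Fin n) :
    i ∈ x.blockOf l i :=
  mem_blockOf.2 (Or.inl rfl)

theorem blockOf_eq_of_mem (hB : B ∈ x.layer l) (hi : i ∈ B) : x.blockOf l i = B := by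
  ext j
  rw [mem_blockOf]
  constructor
  · rintro (rfl | ⟨C, hC, hiC, hjC⟩)
    · exact hi
    · by_contra hj
      have hne : B ≠ C := fun h => hj (h ▸ hjC)
      exact Finset.disjoint_left.1 (x.block_disjoint l B hB C hC hne) hi hiC
  · exact fun hj => Or.inr ⟨B, hB, hi, hj⟩

theorem blockOf_eq_blockOf_iff : x.blockOf l j = x.blockOf l i ↔ j ∈ x.blockOf l i := by
  constructor
  · exact fun h => h ▸ x.mem_blockOf_self l j
  · intro h
    obtain rfl | ⟨B, hB, hi, hj⟩ := mem_blockOf.1 h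
    · rfl
    · rw [blockOf_eq_of_mem hB hi, blockOf_eq_of_mem hB hj]

theorem blockOf_subset (x : WeightedPartition n k) (h : l ≤ l') (i : Fin n) :
    x.blockOf l' i ⊆ x.blockOf l i := by
  intro j hj
  obtain rfl | ⟨B, hB, hi, hj⟩ := mem_blockOf.1 hj
  · exact x.mem_blockOf_self l j
  · obtain ⟨C, hC, hBC⟩ := x.refines l l' h B hB
    exact mem_blockOf.2 (Or.inr ⟨C, hC, hBC hi, hBC hj⟩)

theorem disjoint_blockOf (hB : B ∈ x.layer l) (hne : B ≠ x.blockOf l i) :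
    Disjoint B (x.blockOf l i) := by
  rw [Finset.disjoint_left]
  intro j hjB hji
  exact hne ((blockOf_eq_of_mem hB hjB).symm.trans (blockOf_eq_blockOf_iff.2 hji))

theorem mem_layer_iff : B ∈ x.layer l ↔ (∃ i, x.blockOf l i = B) ∧ (l = 0 ∨ 2 ≤ #B) := by
  constructor
  · intro hB
    obtain ⟨i, hi⟩ := x.block_nonempty l B hB
    exact ⟨⟨i, blockOf_eq_of_mem hB hi⟩, or_iff_not_imp_left.2 fun hl => x.two_le_card l hl B hB⟩
  · rintro ⟨⟨i, rfl⟩, rfl | hcard⟩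
    · exact x.blockOf_zero_mem i
    · obtain ⟨j, hj, hji⟩ := Finset.exists_mem_ne hcard i
      obtain ⟨B, hB, hi, -⟩ := (mem_blockOf.1 hj).resolve_left hji
      rwa [blockOf_eq_of_mem hB hi]

theorem ext_blockOf (h : ∀ l i, x.blockOf l i = y.blockOf l i) : x = y := by
  ext l B
  simp only [mem_layer_iff, h]

/-- The least element of the block of `i` in the `l`-th layer. It serves as a canonical
representative: `x` is determined by the functions `x.least l`. -/
def least (x : WeightedPartition n k) (l : Fin k) (i : Fin n) : Fin n :=
  (x.blockOf l i).min' ⟨i, x.mem_blockOf_self l i⟩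

theorem isLeast_least (x : WeightedPartition n k) (l : Fin k) (i : Fin n) :
    IsLeast (x.blockOf l i : Set (Fin n)) (x.least l i) :=
  isLeast_min' _ _

theorem least_mem (x : WeightedPartition n k) (l : Fin k) (i : Fin n) :
    x.least l i ∈ x.blockOf l i :=
  (x.isLeast_least l i).1

theorem least_le_of_mem (h : j ∈ x.blockOf l i) : x.least l i ≤ j :=
  (x.isLeast_least l i).2 h

theorem least_le (x : WeightedPartition n k) (l : Fin k) (i : Fin n) : x.least l i ≤ i :=
  least_le_of_mem (x.mem_blockOf_self l i)

theorem least_eq_of_blockOf_eq (h : x.blockOf l i = y.blockOf l j) :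
    x.least l i = y.least l j := by
  simp only [least, h]

theorem least_eq_least_iff : x.least l j = x.least l i ↔ j ∈ x.blockOf l i := by
  rw [← blockOf_eq_blockOf_iff]
  constructor
  · intro h
    rw [← blockOf_eq_blockOf_iff.2 (x.least_mem l i), ← blockOf_eq_blockOf_iff.2 (x.least_mem l j),
      h]
  · exact least_eq_of_blockOf_eq

theorem least_least (x : WeightedPartition n k) (h : l ≤ l') (i : Fin n) :
    x.least l (x.least l' i) = x.least l i :=
  least_eq_least_iff.2 (x.blockOf_subset h i (x.least_mem l' i))

theorem least_eq_least_of_le (x : WeightedPartition n k) (h : l ≤ l')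
    (hij : x.least l' i = x.least l' j) : x.least l i = x.least l j := by
  rw [← x.least_least h i, hij, x.least_least h j]

theorem least_eq_self_iff : x.least l i = i ↔ ∀ j ∈ x.blockOf l i, i ≤ j :=
  ⟨fun h _ hj => h.ge.trans (least_le_of_mem hj),
    fun h => le_antisymm (x.least_le l i) (h _ (x.least_mem l i))⟩

theorem least_eq_self_of_le (x : WeightedPartition n k) (h : l ≤ l') (hi : x.least l i = i) :
    x.least l' i = i :=
  least_eq_self_iff.2 fun j hj => least_eq_self_iff.1 hi j (x.blockOf_subset h i hj)

theorem ext_least (h : ∀ l i, x.least l i = y.least l i) : x = y := by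
  refine ext_blockOf fun l i => ?_
  ext j
  rw [← least_eq_least_iff, ← least_eq_least_iff, h, h]

theorem numBlocks_eq_card (x : WeightedPartition n k) :
    x.numBlocks = #{i | x.least 0 i = i} := by
  symm
  refine card_bij (fun i _ => x.blockOf 0 i) (fun i _ => x.blockOf_zero_mem i) ?_ ?_
  · intro i hi j hj h
    rw [← (mem_filter.1 hi).2, ← (mem_filter.1 hj).2]
    exact least_eq_least_iff.2 (blockOf_eq_blockOf_iff.1 h)
  · intro B hB
    obtain ⟨i, rfl⟩ := (mem_layer_iff.1 hB).1
    exact ⟨x.least 0 i, mem_filter.2 ⟨mem_univ _, x.least_least le_rfl i⟩,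
      blockOf_eq_blockOf_iff.2 (x.least_mem 0 i)⟩

theorem numBlocks_mem_Icc (hn : 1 ≤ n) (x : WeightedPartition n k) : x.numBlocks ∈ Icc 1 n := by
  refine mem_Icc.2 ⟨card_pos.2 ⟨_, x.blockOf_zero_mem ⟨0, hn⟩⟩, ?_⟩
  rw [numBlocks_eq_card]
  exact card_finset_fin_le _

theorem least_zeroHat (l : Fin k) (i : Fin n) : (zeroHat n k).least l i = i := by
  refine least_eq_self_iff.2 fun j hj => ?_
  obtain rfl | ⟨B, hB, hi, hj⟩ := mem_blockOf.1 hj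
  · exact le_rfl
  · simp only [zeroHat] at hB
    split_ifs at hB
    · obtain ⟨a, -, rfl⟩ := mem_image.1 hB
      rw [mem_singleton.1 hj, mem_singleton.1 hi]
    · exact absurd hB (notMem_empty B)

theorem eq_zeroHat_iff : x = zeroHat n k ↔ ∀ i, x.least 0 i = i := by
  constructor
  · rintro rfl
    exact least_zeroHat 0
  · intro h
    refine ext_least fun l i => ?_
    rw [least_zeroHat, x.least_eq_self_of_le (Fin.zero_le l) (h i)]

end Blocks

section OfFinpartition

/-- The weighted partition given by a decreasing chain of partitions of the whole ground set; in
the layers after the first, the singleton blocks are discarded. -/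
def ofFinpartition (P : Fin k → Finpartition (univ : Finset (Fin n))) (hP : Antitone P) :
    WeightedPartition n k where
  layer l := {B ∈ (P l).parts | l = 0 ∨ 2 ≤ #B}
  block_nonempty l B hB := (P l).nonempty_of_mem_parts (mem_filter.1 hB).1
  block_disjoint l B hB C hC hne := (P l).disjoint (mem_filter.1 hB).1 (mem_filter.1 hC).1 hne
  first_covers i := ⟨(P 0).part i, by simp, by simp⟩
  two_le_card l hl B hB := (mem_filter.1 hB).2.resolve_left hl
  refines l l' h B hB := by
    obtain ⟨hB, hcard⟩ := mem_filter.1 hB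
    obtain ⟨C, hC, hBC⟩ := hP h hB
    refine ⟨C, mem_filter.2 ⟨hC, ?_⟩, hBC⟩
    rcases hcard with rfl | hcard
    · exact Or.inl (nonpos_iff_eq_zero.1 h)
    · exact Or.inr (hcard.trans (card_le_card hBC))

theorem blockOf_ofFinpartition {P : Fin k → Finpartition (univ : Finset (Fin n))}
    (hP : Antitone P) (l : Fin k) (i : Fin n) :
    (ofFinpartition P hP).blockOf l i = (P l).part i := by
  ext j
  rw [mem_blockOf]
  constructor
  · rintro (rfl | ⟨B, hB, hi, hj⟩)
    · exact (P l).mem_part (mem_univ j)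
    · rwa [(P l).part_eq_of_mem (mem_filter.1 hB).1 hi]
  · intro hj
    have hi : i ∈ (P l).part i := (P l).mem_part (mem_univ i)
    refine or_iff_not_imp_left.2 fun hji => ⟨(P l).part i, ?_, hi, hj⟩
    exact mem_filter.2 ⟨(P l).part_mem.2 (mem_univ i),
      Or.inr (one_lt_card.2 ⟨j, hj, i, hi, hji⟩)⟩

end OfFinpartition

section Merge

/-- The `l'`-th layer of the weighted partition obtained from `x` by merging the blocks of `a` and
`b` in the layers up to the `l`-th one. -/
def mergedLayer (x : WeightedPartition n k) (a b : Fin n) (l l' : Fin k) :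
    Finset (Finset (Fin n)) :=
  if l' ≤ l then
    insert (x.blockOf l' a ∪ x.blockOf l' b)
      (((x.layer l').erase (x.blockOf l' a)).erase (x.blockOf l' b))
  else x.layer l'

variable {x y : WeightedPartition n k} {a b : Fin n} {l l' : Fin k} {B C : Finset (Fin n)}

theorem mem_mergedLayer_of_le (h : l' ≤ l) :
    B ∈ x.mergedLayer a b l l' ↔ B = x.blockOf l' a ∪ x.blockOf l' b ∨
      B ∈ x.layer l' ∧ B ≠ x.blockOf l' a ∧ B ≠ x.blockOf l' b := by
  simp only [mergedLayer, if_pos h, mem_insert, mem_erase]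
  tauto

theorem union_mem_mergedLayer (x : WeightedPartition n k) (a b : Fin n) (h : l' ≤ l) :
    x.blockOf l' a ∪ x.blockOf l' b ∈ x.mergedLayer a b l l' :=
  (mem_mergedLayer_of_le h).2 (Or.inl rfl)

theorem eq_union_or_mem_layer_of_mem_mergedLayer (hB : B ∈ x.mergedLayer a b l l') :
    (l' ≤ l ∧ B = x.blockOf l' a ∪ x.blockOf l' b) ∨ B ∈ x.layer l' := by
  by_cases h : l' ≤ l
  · exact ((mem_mergedLayer_of_le h).1 hB).imp (⟨h, ·⟩) And.left
  · rw [mergedLayer, if_neg h] at hB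
    exact Or.inr hB

theorem exists_subset_mem_mergedLayer (a b : Fin n) (l : Fin k) (hB : B ∈ x.layer l') :
    ∃ C ∈ x.mergedLayer a b l l', B ⊆ C := by
  by_cases h : l' ≤ l
  · have hunion := x.union_mem_mergedLayer a b h
    by_cases ha : B = x.blockOf l' a
    · exact ⟨_, hunion, ha ▸ subset_union_left⟩
    by_cases hb : B = x.blockOf l' b
    · exact ⟨_, hunion, hb ▸ subset_union_right⟩
    · exact ⟨B, (mem_mergedLayer_of_le h).2 (Or.inr ⟨hB, ha, hb⟩), Subset.rfl⟩
  · exact ⟨B, by rwa [mergedLayer, if_neg h], Subset.rfl⟩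

theorem disjoint_of_mem_mergedLayer (hB : B ∈ x.mergedLayer a b l l')
    (hC : C ∈ x.mergedLayer a b l l') (hne : B ≠ C) : Disjoint B C := by
  by_cases h : l' ≤ l
  · rw [mem_mergedLayer_of_le h] at hB hC
    have hunion {D : Finset (Fin n)} (hD : D ∈ x.layer l' ∧ D ≠ x.blockOf l' a ∧
        D ≠ x.blockOf l' b) : Disjoint D (x.blockOf l' a ∪ x.blockOf l' b) :=
      disjoint_union_right.2 ⟨disjoint_blockOf hD.1 hD.2.1, disjoint_blockOf hD.1 hD.2.2⟩
    rcases hB with rfl | hB <;> rcases hC with rfl | hC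
    · exact absurd rfl hne
    · exact (hunion hC).symm
    · exact hunion hB
    · exact x.block_disjoint l' B hB.1 C hC.1 hne
  · rw [mergedLayer, if_neg h] at hB hC
    exact x.block_disjoint l' B hB C hC hne

/-- The weighted partition obtained from `x` by merging the blocks of `a` and `b` in the layers up
to the `l`-th one. -/
def merge (x : WeightedPartition n k) (hab : a ≠ b) (l : Fin k) : WeightedPartition n k where
  layer l' := x.mergedLayer a b l l'
  block_nonempty l' B hB := by
    obtain ⟨-, rfl⟩ | hB := eq_union_or_mem_layer_of_mem_mergedLayer hB
    · exact ⟨a, mem_union_left _ (x.mem_blockOf_self l' a)⟩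
    · exact x.block_nonempty l' B hB
  block_disjoint _ _ hB _ hC := disjoint_of_mem_mergedLayer hB hC
  first_covers i := by
    obtain ⟨C, hC, hsub⟩ := exists_subset_mem_mergedLayer a b l (x.blockOf_zero_mem i)
    exact ⟨C, hC, hsub (x.mem_blockOf_self 0 i)⟩
  two_le_card l' hl' B hB := by
    obtain ⟨-, rfl⟩ | hB := eq_union_or_mem_layer_of_mem_mergedLayer hB
    · exact one_lt_card.2 ⟨a, mem_union_left _ (x.mem_blockOf_self l' a), b,
        mem_union_right _ (x.mem_blockOf_self l' b), hab⟩
    · exact x.two_le_card l' hl' B hB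
  refines l₁ l₂ h B hB := by
    obtain ⟨hl, rfl⟩ | hB := eq_union_or_mem_layer_of_mem_mergedLayer hB
    · exact ⟨_, x.union_mem_mergedLayer a b (h.trans hl),
        union_subset_union (x.blockOf_subset h a) (x.blockOf_subset h b)⟩
    · obtain ⟨C, hC, hBC⟩ := x.refines l₁ l₂ h B hB
      obtain ⟨D, hD, hCD⟩ := exists_subset_mem_mergedLayer a b l hC
      exact ⟨D, hD, hBC.trans hCD⟩

theorem blockOf_merge_of_not_le (hab : a ≠ b) (h : ¬l' ≤ l) (i : Fin n) :
    (x.merge hab l).blockOf l' i = x.blockOf l' i := by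
  simp only [blockOf, merge, mergedLayer, if_neg h]

theorem blockOf_merge_of_mem (hab : a ≠ b) (h : l' ≤ l) {i : Fin n}
    (hi : i ∈ x.blockOf l' a ∪ x.blockOf l' b) :
    (x.merge hab l).blockOf l' i = x.blockOf l' a ∪ x.blockOf l' b :=
  blockOf_eq_of_mem (x := x.merge hab l) (x.union_mem_mergedLayer a b h) hi

theorem blockOf_merge_of_notMem (hab : a ≠ b) {i : Fin n}
    (hi : i ∉ x.blockOf l' a ∪ x.blockOf l' b) :
    (x.merge hab l).blockOf l' i = x.blockOf l' i := by
  have hne {c : Fin n} (hc : i ∉ x.blockOf l' c) {B : Finset (Fin n)} (hiB : i ∈ B) :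
      B ≠ x.blockOf l' c := fun h => hc (h ▸ hiB)
  rw [mem_union, not_or] at hi
  ext j
  rw [mem_blockOf, mem_blockOf]
  refine or_congr_right (exists_congr fun B => and_congr_left fun hB => ?_)
  change B ∈ x.mergedLayer a b l l' ↔ B ∈ x.layer l'
  by_cases h : l' ≤ l
  · rw [mem_mergedLayer_of_le h]
    have ha := hne hi.1 hB.1
    have hb := hne hi.2 hB.1
    have hunion : B ≠ x.blockOf l' a ∪ x.blockOf l' b := by
      rintro rfl
      exact (mem_union.1 hB.1).elim hi.1 hi.2
    simp only [hunion, false_or, ne_eq, ha, hb, not_false_eq_true, and_true]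
  · rw [mergedLayer, if_neg h]

theorem least_merge (hab : a < b) (hb : x.least l' b = b) (i : Fin n) :
    (x.merge hab.ne l).least l' i =
      if l' ≤ l ∧ x.least l' i = b then x.least l' a else x.least l' i := by
  by_cases h : l' ≤ l
  · have ha : x.least l' a < b := (x.least_le l' a).trans_lt hab
    by_cases hi : i ∈ x.blockOf l' a ∪ x.blockOf l' b
    · have hunion : (x.merge hab.ne l).least l' i = x.least l' a := by
        have hleast := (x.isLeast_least l' a).union (x.isLeast_least l' b)
        rw [← coe_union, ← blockOf_merge_of_mem hab.ne h hi, hb, min_eq_left ha.le] at hleast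
        exact (isLeast_least _ l' i).unique hleast
      rw [mem_union, ← least_eq_least_iff, ← least_eq_least_iff, hb] at hi
      grind
    · have hib : x.least l' i ≠ b := fun hib =>
        hi (mem_union_right _ (least_eq_least_iff.1 (hib.trans hb.symm)))
      rw [if_neg fun hc => hib hc.2]
      exact least_eq_of_blockOf_eq (blockOf_merge_of_notMem hab.ne hi)
  · rw [if_neg fun hc => h hc.1]
    exact least_eq_of_blockOf_eq (blockOf_merge_of_not_le hab.ne h i)

theorem admissible_iff : x.Admissible a b l ↔ a < b ∧ x.least 0 b = b ∧ x.least l a = a := by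
  constructor
  · rintro ⟨hab, ⟨-, hb⟩, -, ha, -⟩
    exact ⟨hab, least_eq_self_iff.2 hb, least_eq_self_iff.2 ha⟩
  · rintro ⟨hab, hb, ha⟩
    have hb_layer (l') : x.least l' b = b := x.least_eq_self_of_le (Fin.zero_le l') hb
    have hne (l') : x.blockOf l' a ≠ x.blockOf l' b := fun h =>
      hab.not_ge (least_eq_self_iff.1 (hb_layer l') a (blockOf_eq_blockOf_iff.1 h))
    exact ⟨hab, ⟨hne 0, least_eq_self_iff.1 hb⟩, hne l, least_eq_self_iff.1 ha,
      least_eq_self_iff.1 (hb_layer l)⟩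

theorem cover_iff_exists_merge : Cover x y ↔ ∃ (a b : Fin n) (l : Fin k) (hab : a < b),
    x.least 0 b = b ∧ x.least l a = a ∧ y = x.merge hab.ne l := by
  constructor
  · rintro ⟨a, b, l, hadm, hy⟩
    obtain ⟨hab, hb, ha⟩ := admissible_iff.1 hadm
    exact ⟨a, b, l, hab, hb, ha, WeightedPartition.ext (funext hy)⟩
  · rintro ⟨a, b, l, hab, hb, ha, rfl⟩
    exact ⟨a, b, l, admissible_iff.2 ⟨hab, hb, ha⟩, fun _ => rfl⟩

end Merge

end WeightedPartition

/-- An increasing forest on `Fin n` with edges coloured by `Fin k`, encoded by its edges to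
parents: a vertex `b` is a root (`none`) or is joined to a parent `a < b` by an edge of colour `c`
(`some (a, c)`). -/
abbrev IncreasingForest (n k : ℕ) : Type := (b : Fin n) → Option ({a : Fin n // a < b} × Fin k)

namespace IncreasingForest

variable {n k : ℕ}

/-- The root of the component of `b` in the subforest of the edges of colour at least `l`. -/
def root (F : IncreasingForest n k) (l : Fin k) (b : Fin n) : Fin n :=
  match F b with
  | none => b
  | some (a, c) => if l ≤ c then root F l a else b
termination_by b
decreasing_by exact a.2

section Root

variable {F G : IncreasingForest n k} {b i : Fin n} {c l l' : Fin k}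

theorem root_of_eq_none (h : F b = none) (l : Fin k) : F.root l b = b := by
  rw [root]
  simp only [h]

theorem root_of_eq_some {p : {a : Fin n // a < b} × Fin k} (h : F b = some p) (l : Fin k) :
    F.root l b = if l ≤ p.2 then F.root l p.1 else b := by
  rw [root]
  simp only [h]

theorem root_le (F : IncreasingForest n k) (l : Fin k) (b : Fin n) : F.root l b ≤ b := by
  induction b using WellFoundedLT.induction with
  | _ b ih =>
    rcases h : F b with _ | p
    · rw [root_of_eq_none h]
    · rw [root_of_eq_some h]
      split_ifs
      · exact (ih p.1 p.1.2).trans p.1.2.le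
      · exact le_rfl

theorem root_root (F : IncreasingForest n k) (h : l ≤ l') (b : Fin n) :
    F.root l (F.root l' b) = F.root l b := by
  induction b using WellFoundedLT.induction with
  | _ b ih =>
    rcases hb : F b with _ | p
    · rw [root_of_eq_none hb l']
    · rw [root_of_eq_some hb l']
      split_ifs with hc
      · rw [ih p.1 p.1.2, root_of_eq_some hb, if_pos (h.trans hc)]
      · rfl

theorem root_eq_self_iff : F.root l b = b ↔ ∀ p ∈ F b, p.2 < l := by
  rcases h : F b with _ | p
  · simp [root_of_eq_none h]
  · have hlt : F.root l p.1 < b := (F.root_le l p.1).trans_lt p.1.2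
    simp [root_of_eq_some h, hlt.ne]

theorem root_zero_eq_self_iff [NeZero k] : F.root 0 b = b ↔ F b = none := by
  simp [root_eq_self_iff, Option.eq_none_iff_forall_ne_some]

theorem root_congr (h : ∀ j ≤ i, F j = G j) (l : Fin k) : F.root l i = G.root l i := by
  induction i using WellFoundedLT.induction with
  | _ i ih =>
    rcases hF : F i with _ | p
    · rw [root_of_eq_none hF, root_of_eq_none ((h i le_rfl).symm.trans hF)]
    · rw [root_of_eq_some hF, root_of_eq_some ((h i le_rfl).symm.trans hF),
        ih p.1 p.1.2 fun j hj => h j (hj.trans p.1.2.le)]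

theorem root_update (hb : F b = none) (p : {a : Fin n // a < b} × Fin k) (l : Fin k)
    (i : Fin n) : root (Function.update F b (some p)) l i =
      if l ≤ p.2 ∧ F.root l i = b then F.root l p.1 else F.root l i := by
  set G : IncreasingForest n k := Function.update F b (some p) with hG
  have hG_self : G b = some p := Function.update_self ..
  have hG_ne {j : Fin n} (hj : j ≠ b) : G j = F j := Function.update_of_ne hj ..
  have hroot_parent : G.root l p.1 = F.root l p.1 :=
    root_congr (fun j hj => hG_ne (hj.trans_lt p.1.2).ne) l
  induction i using WellFoundedLT.induction with
  | _ i ih =>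
    by_cases hi : i = b
    · subst hi
      simp only [root_of_eq_some hG_self, root_of_eq_none hb, hroot_parent, and_true]
    · rcases hF : F i with _ | q
      · simp only [root_of_eq_none hF, root_of_eq_none ((hG_ne hi).trans hF), hi, and_false,
          if_false]
      · rw [root_of_eq_some hF, root_of_eq_some ((hG_ne hi).trans hF), ih q.1 q.1.2]
        split_ifs <;> simp_all

end Root

section Weight

variable {R : Type*} [CommRing R]

/-- The weight of a forest: each root contributes a factor `t` and each edge a factor `-1`. -/
def weight (t : R) (F : IncreasingForest n k) : R := ∏ b, (F b).elim t fun _ => -1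

theorem weight_X (F : IncreasingForest n k) :
    F.weight (X : R[X]) = C (F.weight 1) * X ^ #{b | F b = none} := by
  rw [weight, weight, map_prod, ← prod_const, prod_filter, ← prod_mul_distrib]
  refine prod_congr rfl fun b _ => ?_
  rcases F b with _ | p <;> simp

theorem sum_weight_piFinset (s : (b : Fin n) → Finset ({a : Fin n // a < b} × Fin k)) (t : R) :
    ∑ F ∈ Fintype.piFinset fun b => insertNone (s b), weight t F = ∏ b, (t - #(s b)) := by
  simp only [weight]
  rw [← prod_univ_sum (fun b => insertNone (s b)) fun _ o => o.elim t fun _ => -1]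
  simp [sum_insertNone, sub_eq_add_neg]

theorem sum_weight (t : R) :
    ∑ F : IncreasingForest n k, F.weight t = ∏ j ∈ range n, (t - k * j) := by
  have hcard (b : Fin n) : #(univ : Finset ({a : Fin n // a < b} × Fin k)) = k * b := by
    have hlt : #{a | a < b} = (b : ℕ) := by rw [filter_gt_eq_Iio, Fin.card_Iio]
    simp [Fintype.card_subtype, hlt, mul_comm]
  have h_univ : (Fintype.piFinset fun b : Fin n =>
      insertNone (univ : Finset ({a : Fin n // a < b} × Fin k))) = univ :=
    eq_univ_of_forall fun F => by simp
  have h := sum_weight_piFinset (fun b : Fin n => (univ : Finset ({a // a < b} × Fin k))) t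
  rw [← Fin.prod_univ_eq_prod_range (fun j => t - k * j)]
  simpa only [hcard, h_univ, Nat.cast_mul] using h

end Weight

section ToPartition

open Classical in
/-- The partition of the vertices into the components of the subforest of the edges of colour at
least `l`; two vertices are in the same component if and only if they have the same root. -/
noncomputable def components (F : IncreasingForest n k) (l : Fin k) :
    Finpartition (univ : Finset (Fin n)) :=
  Finpartition.ofSetoid (Setoid.ker (F.root l))

theorem mem_part_components {F : IncreasingForest n k} {l : Fin k} {i j : Fin n} :
    j ∈ (F.components l).part i ↔ F.root l i = F.root l j := by
  classical
  rw [components, Finpartition.mem_part_ofSetoid_iff_rel, Setoid.ker_def]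

theorem antitone_components (F : IncreasingForest n k) : Antitone F.components := by
  classical
  intro l l' h
  refine finpartition_ofSetoid_mono fun i j (hij : F.root l' i = F.root l' j) => ?_
  rw [Setoid.ker_def, ← F.root_root h i, hij, F.root_root h j]

variable [NeZero k]

/-- The weighted partition whose blocks in the `l`-th layer are the components of the subforest of
the edges of colour at least `l`. -/
noncomputable def toPartition (F : IncreasingForest n k) : WeightedPartition n k :=
  WeightedPartition.ofFinpartition F.components F.antitone_components

theorem least_toPartition (F : IncreasingForest n k) (l : Fin k) (b : Fin n) :
    F.toPartition.least l b = F.root l b := by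
  have hmem {j : Fin n} : j ∈ F.toPartition.blockOf l b ↔ F.root l b = F.root l j := by
    rw [toPartition, WeightedPartition.blockOf_ofFinpartition, mem_part_components]
  refine (F.toPartition.isLeast_least l b).unique ⟨?_, fun j hj => ?_⟩
  · exact hmem.2 (F.root_root le_rfl b).symm
  · rw [hmem.1 hj]
    exact F.root_le l j

theorem numBlocks_toPartition (F : IncreasingForest n k) :
    F.toPartition.numBlocks = #{b | F b = none} := by
  simp only [WeightedPartition.numBlocks_eq_card, least_toPartition, root_zero_eq_self_iff]

theorem toPartition_eq_zeroHat_iff {F : IncreasingForest n k} :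
    F.toPartition = WeightedPartition.zeroHat n k ↔ ∀ b, F b = none := by
  simp only [WeightedPartition.eq_zeroHat_iff, least_toPartition, root_zero_eq_self_iff]

theorem cover_toPartition_update {F : IncreasingForest n k} {b : Fin n} (hb : F b = none)
    (p : {a : Fin n // a < b} × Fin k) (hp : F.root p.2 p.1 = p.1) :
    WeightedPartition.Cover F.toPartition (toPartition (Function.update F b (some p))) := by
  have hleast (l) : F.toPartition.least l b = b := by rw [least_toPartition, root_of_eq_none hb]
  refine WeightedPartition.cover_iff_exists_merge.2 ⟨p.1, b, p.2, p.1.2, hleast 0, ?_, ?_⟩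
  · rw [least_toPartition, hp]
  · refine WeightedPartition.ext_least fun l i => ?_
    simp only [WeightedPartition.least_merge p.1.2 (hleast l), least_toPartition, root_update hb]

end ToPartition

end IncreasingForest

namespace WeightedPartition

variable {n k : ℕ} [NeZero k]

/-- The edges, encoded as pairs of a parent `a` and a colour `c`, that may join `b` to a parent in
a forest lying below `x`: the colour is the deepest layer in which `b` is not the least element of
its block, and the parent lies in that block. -/
def parentEdges (x : WeightedPartition n k) (b : Fin n) : Finset ({a : Fin n // a < b} × Fin k) :=
  {p | x.least p.2 p.1 = x.least p.2 b ∧ ∀ l, p.2 < l → x.least l b = b}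

section ParentEdges

variable {x y : WeightedPartition n k} {b : Fin n} {p q : {a : Fin n // a < b} × Fin k}

theorem mem_parentEdges :
    p ∈ x.parentEdges b ↔ x.least p.2 p.1 = x.least p.2 b ∧ ∀ l, p.2 < l → x.least l b = b := by
  simp [parentEdges]

theorem least_lt_of_mem_parentEdges (hp : p ∈ x.parentEdges b) : x.least p.2 b < b :=
  (mem_parentEdges.1 hp).1 ▸ (x.least_le p.2 p.1).trans_lt p.1.2

theorem color_eq_of_mem_parentEdges (hp : p ∈ x.parentEdges b) (hq : q ∈ x.parentEdges b) :
    p.2 = q.2 := by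
  rcases lt_trichotomy p.2 q.2 with h | h | h
  · exact absurd ((mem_parentEdges.1 hp).2 _ h) (least_lt_of_mem_parentEdges hq).ne
  · exact h
  · exact absurd ((mem_parentEdges.1 hq).2 _ h) (least_lt_of_mem_parentEdges hp).ne

theorem Cover.parentEdges_subset (h : Cover x y) (i : Fin n) :
    x.parentEdges i ⊆ y.parentEdges i := by
  obtain ⟨a, b, l, hab, hb, -, rfl⟩ := cover_iff_exists_merge.1 h
  have hb_layer (l') : x.least l' b = b := x.least_eq_self_of_le (Fin.zero_le l') hb
  intro p hp
  obtain ⟨hparent, hdeep⟩ := mem_parentEdges.1 hp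
  refine mem_parentEdges.2 ⟨?_, fun l' hl' => ?_⟩
  · rw [least_merge hab (hb_layer _), least_merge hab (hb_layer _), hparent]
  · have hib : i ≠ b := by
      rintro rfl
      exact (least_lt_of_mem_parentEdges hp).ne (hb_layer p.2)
    rw [least_merge hab (hb_layer l'), hdeep l' hl', if_neg fun hc => hib hc.2]

theorem parentEdges_mono (h : x ≤ y) (b : Fin n) : x.parentEdges b ⊆ y.parentEdges b := by
  induction h with
  | refl => exact Subset.rfl
  | tail _ hcover ih => exact ih.trans (hcover.parentEdges_subset b)

theorem exists_mem_parentEdges (hb : x.least 0 b ≠ b) :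
    ∃ p ∈ x.parentEdges b, x.least p.2 p.1 = p.1 := by
  obtain ⟨c, hc⟩ := (Set.toFinite {l | x.least l b ≠ b}).exists_maximal ⟨0, hb⟩
  have hlt : x.least c b < b := lt_of_le_of_ne (x.least_le c b) hc.prop
  have hleast : x.least c (x.least c b) = x.least c b := x.least_least le_rfl b
  refine ⟨(⟨x.least c b, hlt⟩, c), mem_parentEdges.2 ⟨hleast, fun l hl => ?_⟩, hleast⟩
  by_contra h
  exact hc.not_prop_of_gt hl h

theorem parentEdges_zeroHat (b : Fin n) : (zeroHat n k).parentEdges b = ∅ :=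
  eq_empty_of_forall_notMem fun _ hp =>
    (least_lt_of_mem_parentEdges hp).ne (least_zeroHat _ b)

/-- The first vertex that is not the least one in its first-layer block works: all smaller vertices
are the least ones in their blocks, so only one of them is in its block. -/
theorem exists_card_parentEdges_eq_one (hx : x ≠ zeroHat n k) : ∃ b, #(x.parentEdges b) = 1 := by
  obtain ⟨b, hb⟩ : ∃ b, Minimal (fun b => x.least 0 b ≠ b) b := by
    simp only [ne_eq, eq_zeroHat_iff, not_forall] at hx
    exact exists_minimal_of_wellFoundedLT _ hx
  have hsmaller (a : Fin n) (ha : a < b) (l : Fin k) : x.least l a = a :=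
    x.least_eq_self_of_le (Fin.zero_le l) (not_not.1 (hb.not_prop_of_lt ha))
  obtain ⟨p, hp, -⟩ := exists_mem_parentEdges hb.prop
  refine ⟨b, card_eq_one.2 ⟨p, eq_singleton_iff_unique_mem.2 ⟨hp, fun q hq => ?_⟩⟩⟩
  have hcolor := color_eq_of_mem_parentEdges hq hp
  have hparent : (q.1 : Fin n) = p.1 := by
    rw [← hsmaller q.1 q.1.2 q.2, ← hsmaller p.1 p.1.2 p.2, (mem_parentEdges.1 hq).1,
      (mem_parentEdges.1 hp).1, hcolor]
  exact Prod.ext (Subtype.ext hparent) hcolor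

end ParentEdges

/-- The forests all of whose edges are parent edges of `x`. -/
def compatibleForests (x : WeightedPartition n k) : Finset (IncreasingForest n k) :=
  Fintype.piFinset fun b => insertNone (x.parentEdges b)

section Compatible

variable {x : WeightedPartition n k} {F : IncreasingForest n k}

theorem mem_compatibleForests :
    F ∈ x.compatibleForests ↔ ∀ b, ∀ p ∈ F b, p ∈ x.parentEdges b := by
  simp only [compatibleForests, Fintype.mem_piFinset, mem_insertNone]

theorem sum_weight_compatibleForests (x : WeightedPartition n k) :
    ∑ F ∈ x.compatibleForests, F.weight (1 : ℤ) = if x = zeroHat n k then 1 else 0 := by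
  rw [compatibleForests, IncreasingForest.sum_weight_piFinset]
  split_ifs with hx
  · simp [hx, parentEdges_zeroHat]
  · obtain ⟨b, hb⟩ := exists_card_parentEdges_eq_one hx
    exact prod_eq_zero (mem_univ b) (by rw [hb, Nat.cast_one, sub_self])

theorem mem_compatibleForests_toPartition (F : IncreasingForest n k) :
    F ∈ F.toPartition.compatibleForests := by
  refine mem_compatibleForests.2 fun b p hp => mem_parentEdges.2 ?_
  simp only [IncreasingForest.least_toPartition, IncreasingForest.root_of_eq_some hp]
  exact ⟨by rw [if_pos le_rfl], fun l hl => if_neg hl.not_ge⟩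

theorem least_root (hF : F ∈ x.compatibleForests) (l : Fin k) (b : Fin n) :
    x.least l (F.root l b) = x.least l b := by
  induction b using WellFoundedLT.induction with
  | _ b ih =>
    rcases hb : F b with _ | p
    · rw [IncreasingForest.root_of_eq_none hb]
    · rw [IncreasingForest.root_of_eq_some hb]
      split_ifs with hc
      · rw [ih p.1 p.1.2]
        exact x.least_eq_least_of_le hc (mem_parentEdges.1 (mem_compatibleForests.1 hF b p hb)).1
      · rfl

theorem root_eq_self_of_least_eq_self (hF : F ∈ x.compatibleForests) {l : Fin k} {b : Fin n}
    (hb : x.least l b = b) : F.root l b = b := by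
  refine le_antisymm (F.root_le l b) ?_
  calc b = x.least l (F.root l b) := by rw [least_root hF, hb]
    _ ≤ F.root l b := x.least_le l _

theorem toPartition_eq_of_forall_least_eq_self (hF : F ∈ x.compatibleForests)
    (hroots : ∀ b, F b = none → x.least 0 b = b) : F.toPartition = x := by
  have hleast {l : Fin k} {b : Fin n} (hb : F.root l b = b) : x.least l b = b := by
    rcases hFb : F b with _ | p
    · exact x.least_eq_self_of_le (Fin.zero_le l) (hroots b hFb)
    · exact (mem_parentEdges.1 (mem_compatibleForests.1 hF b p hFb)).2 l
        (IncreasingForest.root_eq_self_iff.1 hb p hFb)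
  refine ext_least fun l b => ?_
  rw [IncreasingForest.least_toPartition, ← least_root hF, hleast (F.root_root le_rfl b)]

theorem exists_cover_toPartition (hF : F ∈ x.compatibleForests) (hne : F.toPartition ≠ x) :
    ∃ G ∈ x.compatibleForests, Cover F.toPartition G.toPartition := by
  obtain ⟨b, hb, hleast⟩ : ∃ b, F b = none ∧ x.least 0 b ≠ b := by
    by_contra! h
    exact hne (toPartition_eq_of_forall_least_eq_self hF h)
  obtain ⟨p, hp, hp_least⟩ := exists_mem_parentEdges hleast
  refine ⟨Function.update F b (some p), mem_compatibleForests.2 fun i q hq => ?_,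
    IncreasingForest.cover_toPartition_update hb p (root_eq_self_of_least_eq_self hF hp_least)⟩
  by_cases hi : i = b
  · subst hi
    rw [Function.update_self, Option.mem_some_iff] at hq
    exact hq ▸ hp
  · rw [Function.update_of_ne hi] at hq
    exact mem_compatibleForests.1 hF i q hq

theorem toPartition_le_of_mem_compatibleForests (hF : F ∈ x.compatibleForests) :
    F.toPartition ≤ x := by
  induction h : F.toPartition.numBlocks using Nat.strong_induction_on generalizing F with
  | _ m ih =>
    by_cases hne : F.toPartition = x
    · exact hne.le
    · obtain ⟨G, hG, hcover⟩ := exists_cover_toPartition hF hne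
      exact .head hcover (ih _ (h ▸ hcover.numBlocks_lt) hG rfl)

theorem toPartition_le_iff : F.toPartition ≤ x ↔ F ∈ x.compatibleForests :=
  ⟨fun h => mem_compatibleForests.2 fun b p hp => parentEdges_mono h b
    (mem_compatibleForests.1 (mem_compatibleForests_toPartition F) b p hp),
    toPartition_le_of_mem_compatibleForests⟩

theorem zeroHat_le (x : WeightedPartition n k) : zeroHat n k ≤ x := by
  have hempty : (fun _ => none : IncreasingForest n k) ∈ x.compatibleForests :=
    mem_compatibleForests.2 fun _ _ hp => absurd hp (Option.not_mem_none _)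
  rw [← IncreasingForest.toPartition_eq_zeroHat_iff.2 fun _ => rfl]
  exact toPartition_le_of_mem_compatibleForests hempty

noncomputable instance : OrderBot (WeightedPartition n k) where
  bot := zeroHat n k
  bot_le := zeroHat_le

end Compatible

section CharPoly

theorem mu_zeroHat_eq_sum_weight (x : WeightedPartition n k) :
    IncidenceAlgebra.mu ℤ (zeroHat n k) x =
      ∑ F : IncreasingForest n k with F.toPartition = x, F.weight 1 := by
  classical
  refine mu_bot_eq_sum_fiber _ _ (fun y => ?_) x
  simp only [toPartition_le_iff, filter_univ_mem]
  exact sum_weight_compatibleForests y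

theorem sum_mu_mul_X_pow_numBlocks (n k : ℕ) [NeZero k] :
    ∑ x : WeightedPartition n k, C (IncidenceAlgebra.mu ℤ (zeroHat n k) x) * X ^ x.numBlocks =
      ∏ j ∈ range n, (X - C ((k : ℤ) * j)) := by
  calc
    _ = ∑ x : WeightedPartition n k,
          ∑ F : IncreasingForest n k with F.toPartition = x, F.weight (X : ℤ[X]) := by
        refine sum_congr rfl fun x _ => ?_
        rw [mu_zeroHat_eq_sum_weight, map_sum, sum_mul]
        refine sum_congr rfl fun F hF => ?_
        rw [IncreasingForest.weight_X, ← IncreasingForest.numBlocks_toPartition,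
          (mem_filter.1 hF).2]
    _ = ∑ F : IncreasingForest n k, F.weight (X : ℤ[X]) := sum_fiberwise _ _ _
    _ = ∏ j ∈ range n, (X - C ((k : ℤ) * j)) := by simp [IncreasingForest.sum_weight]

theorem charPoly_eq_sum_mu (hn : 1 ≤ n) (k : ℕ) [NeZero k] :
    charPoly n k = ∑ x : WeightedPartition n k,
      C (IncidenceAlgebra.mu ℤ (zeroHat n k) x) * X ^ x.numBlocks := by
  rw [charPoly, ← sum_fiberwise_of_maps_to fun x _ => numBlocks_mem_Icc hn x]
  refine sum_congr rfl fun r _ => ?_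
  rw [whitneyFirst, map_sum, sum_mul]
  exact sum_congr rfl fun x hx => by rw [(mem_filter.1 hx).2]

theorem whitneyFirst_eq_coeff (n k : ℕ) [NeZero k] (r : ℕ) :
    whitneyFirst n k r = (∏ j ∈ range n, (X - C ((k : ℤ) * j))).coeff r := by
  rw [← sum_mu_mul_X_pow_numBlocks, finsetSum_coeff, whitneyFirst, sum_filter]
  simp only [coeff_C_mul_X_pow, eq_comm]

theorem whitneyFirst_eq_pow_mul_signedStirlingFirst (n k : ℕ) [NeZero k] (r : ℕ) :
    whitneyFirst n k r = (k : ℤ) ^ (n - r) * signedStirlingFirst n r := by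
  rw [whitneyFirst_eq_coeff, ← scaleRoots_descPochhammer, coeff_scaleRoots,
    descPochhammer_natDegree, mul_comm, signedStirlingFirst]

end CharPoly

end WeightedPartition

theorem mainTheorem3 (n k : ℕ) [NeZero k] (hn : 1 ≤ n) :
    WeightedPartition.charPoly n k = ∏ j ∈ Finset.range n, (X - C ((k : ℤ) * (j : ℤ))) ∧
      ∀ r : ℕ, 1 ≤ r → r ≤ n →
        WeightedPartition.whitneyFirst n k r =
          (k : ℤ) ^ (n - r) * signedStirlingFirst n r := by
  constructor
  · rw [WeightedPartition.charPoly_eq_sum_mu hn, WeightedPartition.sum_mu_mul_X_pow_numBlocks]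
  · intro r _ _
    exact WeightedPartition.whitneyFirst_eq_pow_mul_signedStirlingFirst n k r
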